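/- **Variation.** Let $\sigma\subset\mathbb C$ be non-empty and compact and let $f:\sigma\to\mathbb C$. For a finite list $S=[x_0,\dots,x_n]$ of points of $\sigma$ with $x_{i}\ne x_{i+1}$ for all $i$, put $\operatorname{cvar}(f,S)=\sum_{i=1}^n|f(x_i)-f(x_{i-1})|$. For a line $\ell$, the segment from $x_i$ to $x_{i+1}$ is a *crossing segment* of $S$ on $\ell$ if $x_i,x_{i+1}$ lie strictly on opposite sides of $\ell$, or $i=0$ and $x_0\in\ell$, or $x_i\notin\ell$ and $x_{i+1}\in\ell$. Let $\operatorname{vf}(S)$ be the maximum over all lines $\ell$ of the number of crossing segments of $S$ on $\ell$ (with $\operatorname{vf}([x_0])=1$). Put $\operatorname{var}(f,\sigma)=\sup_S \operatorname{cvar}(f,S)/\operatorname{vf}(S)$, $\|f\|_{BV(\sigma)}=\|f\|_\infty+\operatorname{var}(f,\sigma)$, and $BV(\sigma)=\{f:\|f\|_{BV(\sigma)}<\infty\}$. **Curves.** A *differentiable convex curve* is a simple arc $c$ of finite length with distinct endpoints, with an arc-length parametrization $\gamma:[0,L]\to\mathbb C$ that is differentiable on $(0,L)$, and with a supporting line through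 each of its points. It is *projectable* if its orthogonal projection onto the line through its endpoints is exactly the segment joining the endpoints. Write $\operatorname{pvar}(f,c)$ for the total variation of $f\circ\gamma$ on $[0,L]$. **Mosaics.** A *polygonal mosaic* is a finite collection $\mathcal M=\{P_1,\dots,P_M\}$ of distinct convex polygons (with their interiors) whose union is connected and such that any two distinct members that intersect do so either in a single point which is a vertex of both, or in a segment which is a full side of both. Let $S(\mathcal M)$ be the largest number of sides of a $P_i$. A non-empty compact connected set $\sigma$ is a *polygonally inscribed curve*, $\sigma\in\mathrm{PIC}$, if there is a polygonal mosaic $\{P_1,\dots,P_M\}$ covering $\sigma$ such that each $c_i=\sigma\cap P_i$ is a differentiable convex curve joining two vertices of $P_i$ and meeting the boundary of $P_i$ only at those two points; then $\sigma=\bigcup_i c_i$, and the $c_i$ are the components. The mosaic is *simple* for $\sigma$ if no two components have the same pair of endpoints. **Statement.** Let $\sigma\in\mathrm{PIC}$, decomposed as $\sigma=\bigcup_{i=1}^M c_i$ by a polygonal mosaic $\mathcal M$ which is simple for $\sigma$ and for which every $c_i$ is projectable, and put $$\|f\|_{\mathrm{PIC}(\sigma)}=\|f\|_\infty+\sum_{i=1}^M\operatorname{pvar}(f,c_i).$$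 Then $\|\cdot\|_{\mathrm{PIC}(\sigma)}$ is equivalent to $\|\cdot\|_{BV(\sigma)}$: one has $BV(\sigma)=\{f:\sigma\to\mathbb C:\|f\|_{\mathrm{PIC}(\sigma)}<\infty\}$, and for every $f:\sigma\to\mathbb C$ (both quantities being allowed to be infinite) $$\|f\|_{\mathrm{PIC}(\sigma)}\le 2M\,\|f\|_{BV(\sigma)},\qquad \|f\|_{BV(\sigma)}\le\bigl(M+2(M-1)S(\mathcal M)\bigr)\,\|f\|_{\mathrm{PIC}(\sigma)}.$$ -/

import Mathlib

open scoped ENNReal InnerProductSpace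

noncomputable section

namespace PolyInscribed

/-! ### Two-dimensional variation

The plane is `ℂ`, with its usual structure of a real inner product space.  A finite list
`[x 0, …, x n]` is given by its length index `n` and a sequence `x`, of which only the terms
`x 0, …, x n` are used. -/

/-- A set `ℓ` is a line in the plane. -/
def IsLine (ℓ : AffineSubspace ℝ ℂ) : Prop :=
  ∃ p q : ℂ, p ≠ q ∧ ℓ = line[ℝ, p, q]

/-- The segment from `x i` to `x (i + 1)` is a crossing segment of the list on `ℓ`: its ends lie
strictly on opposite sides of `ℓ`, or `i = 0` and `x 0 ∈ ℓ`, or it ends, but does not start,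
on `ℓ`. -/
def IsCrossing (ℓ : AffineSubspace ℝ ℂ) (x : ℕ → ℂ) (i : ℕ) : Prop :=
  ℓ.SOppSide (x i) (x (i + 1)) ∨ (i = 0 ∧ x i ∈ ℓ) ∨ (x i ∉ ℓ ∧ x (i + 1) ∈ ℓ)

open Classical in
/-- The number of crossing segments of `[x 0, …, x n]` on `ℓ`; for the one-term list `[x 0]` it is
`1` if `x 0 ∈ ℓ` and `0` otherwise. -/
def crossingCount (ℓ : AffineSubspace ℝ ℂ) (n : ℕ) (x : ℕ → ℂ) : ℕ :=
  if n = 0 then (if x 0 ∈ ℓ then 1 else 0)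
  else ((Finset.range n).filter (fun i => IsCrossing ℓ x i)).card

/-- The variation factor of `[x 0, …, x n]`: the largest number of crossing segments on a line. -/
def variationFactor (n : ℕ) (x : ℕ → ℂ) : ℝ≥0∞ :=
  ⨆ (ℓ : AffineSubspace ℝ ℂ) (_ : IsLine ℓ), (crossingCount ℓ n x : ℝ≥0∞)

/-- The curve variation of `f` on `[x 0, …, x n]`. -/
def curveVariation {σ : Set ℂ} (f : σ → ℂ) (n : ℕ) (x : ℕ → σ) : ℝ≥0∞ :=
  ∑ i ∈ Finset.range n, ‖f (x (i + 1)) - f (x i)‖ₑ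

/-- The two-dimensional variation of `f : σ → ℂ`: the supremum of curve variation over variation
factor, over all finite lists of elements of `σ` whose consecutive terms are distinct. -/
def variation {σ : Set ℂ} (f : σ → ℂ) : ℝ≥0∞ :=
  ⨆ (n : ℕ) (x : ℕ → σ) (_ : ∀ i < n, x i ≠ x (i + 1)),
    curveVariation f n x / variationFactor n (fun i => (x i : ℂ))

/-- The supremum norm of `f : σ → ℂ`, possibly infinite. -/
def supNorm {σ : Set ℂ} (f : σ → ℂ) : ℝ≥0∞ := ⨆ z : σ, ‖f z‖ₑ

/-- The norm of `BV(σ)`, possibly infinite. -/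
def bvNorm {σ : Set ℂ} (f : σ → ℂ) : ℝ≥0∞ := supNorm f + variation f

/-- The functions of bounded variation on `σ`. -/
def BV (σ : Set ℂ) : Set (σ → ℂ) := {f | bvNorm f < ∞}

/-! ### Convex curves -/

/-- A differentiable convex curve with distinct endpoints: a simple arc of finite length, with an
arc-length parametrization on `[0, length]` which is differentiable except possibly at the two
ends, that has a supporting line through each of its points. -/
structure ConvexCurve where
  length : ℝ
  length_pos : 0 < length
  param : ℝ → ℂ
  continuousOn : ContinuousOn param (Set.Icc 0 length)
  injOn : Set.InjOn param (Set.Icc 0 length)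
  differentiableAt : ∀ t ∈ Set.Ioo 0 length, DifferentiableAt ℝ param t
  norm_deriv : ∀ t ∈ Set.Ioo 0 length, ‖deriv param t‖ = 1
  supporting : ∀ s ∈ Set.Icc 0 length, ∃ u : ℂ, u ≠ 0 ∧
    ∀ t ∈ Set.Icc 0 length, 0 ≤ ⟪u, param t - param s⟫_ℝ

namespace ConvexCurve

/-- The curve as a set of points. -/
def carrier (c : ConvexCurve) : Set ℂ := c.param '' Set.Icc 0 c.length

/-- The initial endpoint. -/
def source (c : ConvexCurve) : ℂ := c.param 0

/-- The final endpoint. -/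
def target (c : ConvexCurve) : ℂ := c.param c.length

/-- The orthogonal projection of the curve onto the line through its endpoints is the segment
joining the endpoints. -/
def IsProjectable (c : ConvexCurve) : Prop :=
  (fun z : ℂ => (EuclideanGeometry.orthogonalProjection line[ℝ, c.source, c.target] z : ℂ)) ''
    c.carrier = segment ℝ c.source c.target

/-- The parametrized variation of a function on the curve: the classical total variation of
`f ∘ param` on `[0, length]`. -/
def pvar (c : ConvexCurve) (f : c.carrier → ℂ) : ℝ≥0∞ :=
  eVariationOn
    (fun t : Set.Icc (0 : ℝ) c.length => f ⟨c.param t, Set.mem_image_of_mem c.param t.2⟩) Set.univ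

end ConvexCurve

/-! ### Convex polygons and polygonal mosaics -/

/-- The cross product (signed area of the parallelogram) of two plane vectors. -/
def cross (a b : ℂ) : ℝ := a.re * b.im - a.im * b.re

/-- A convex polygon with `extra + 3 ≥ 3` vertices, listed in counterclockwise order; indices are
cyclic, so that `i + 1` is the index after `i`.  Every vertex off the directed side from
`vertex i` to `vertex (i + 1)` lies strictly to the left of that side. -/
structure ConvexPolygon where
  extra : ℕ
  vertex : Fin (extra + 3) → ℂ
  left_of_side : ∀ i j, j ≠ i → j ≠ i + 1 →
    0 < cross (vertex (i + 1) - vertex i) (vertex j - vertex i)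

namespace ConvexPolygon

/-- The polygon, with its interior, as a set of points. -/
def carrier (P : ConvexPolygon) : Set ℂ := convexHull ℝ (Set.range P.vertex)

/-- The sides of the polygon. -/
def side (P : ConvexPolygon) (i : Fin (P.extra + 3)) : Set ℂ :=
  segment ℝ (P.vertex i) (P.vertex (i + 1))

/-- The number of sides. -/
def numSides (P : ConvexPolygon) : ℕ := P.extra + 3

end ConvexPolygon

/-- A polygonal mosaic of `M` distinct convex polygons: their union is connected, and two of them
that intersect have in common either a single vertex of both or a full side of both. -/
structure PolygonalMosaic (M : ℕ) where
  polygon : Fin M → ConvexPolygon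
  distinct : Function.Injective (fun i => (polygon i).carrier)
  connected : IsConnected (⋃ i, (polygon i).carrier)
  inter : ∀ i j, i ≠ j → ((polygon i).carrier ∩ (polygon j).carrier).Nonempty →
    (∃ k l, (polygon i).vertex k = (polygon j).vertex l ∧
      (polygon i).carrier ∩ (polygon j).carrier = {(polygon i).vertex k}) ∨
    (∃ k l, (polygon i).side k = (polygon j).side l ∧
      (polygon i).carrier ∩ (polygon j).carrier = (polygon i).side k)

/-- `S(𝓜)`, the largest number of sides of a polygon of the mosaic. -/
def PolygonalMosaic.maxSides {M : ℕ} (𝓜 : PolygonalMosaic M) : ℕ :=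
  Finset.univ.sup (fun i => (𝓜.polygon i).numSides)

/-! ### Polygonally inscribed curves -/

/-- A decomposition `σ = c₁ ∪ ⋯ ∪ c_M` given by a polygonal mosaic `P₁, …, P_M`: the polygons
cover `σ`, and each `σ ∩ P_i` is a differentiable convex curve `c_i` that joins two vertices of
`P_i` and meets the boundary of `P_i` only there. -/
structure Decomposition (σ : Set ℂ) (M : ℕ) where
  mosaic : PolygonalMosaic M
  component : Fin M → ConvexCurve
  covers : σ ⊆ ⋃ i, (mosaic.polygon i).carrier
  carrier_eq : ∀ i, (component i).carrier = σ ∩ (mosaic.polygon i).carrier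
  source_mem : ∀ i, (component i).source ∈ Set.range (mosaic.polygon i).vertex
  target_mem : ∀ i, (component i).target ∈ Set.range (mosaic.polygon i).vertex
  inter_frontier : ∀ i, (component i).carrier ∩ frontier (mosaic.polygon i).carrier =
    {(component i).source, (component i).target}

/-- The polygonally inscribed curves. -/
def PIC : Set (Set ℂ) :=
  {σ | IsCompact σ ∧ IsConnected σ ∧ ∃ M : ℕ, Nonempty (Decomposition σ M)}

namespace Decomposition

variable {σ : Set ℂ} {M : ℕ}

/-- The mosaic is simple for `σ`: no two components have the same pair of endpoints. -/
def IsSimple (D : Decomposition σ M) : Prop :=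
  ∀ i j, i ≠ j → s((D.component i).source, (D.component i).target) ≠
    s((D.component j).source, (D.component j).target)

/-- Every component is a projectable convex curve. -/
def IsProjectable (D : Decomposition σ M) : Prop := ∀ i, (D.component i).IsProjectable

theorem component_subset (D : Decomposition σ M) (i : Fin M) : (D.component i).carrier ⊆ σ :=
  (D.carrier_eq i).trans_subset Set.inter_subset_left

/-- The PIC norm of `f`, possibly infinite: the supremum norm plus the sum of the parametrized
variations of (the restrictions of) `f` on the components. -/
def picNorm (D : Decomposition σ M) (f : σ → ℂ) : ℝ≥0∞ :=
  supNorm f + ∑ i, (D.component i).pvar (f ∘ Set.inclusion (D.component_subset i))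

end Decomposition

end PolyInscribed

end

/-!
The two inequalities compare lists of points with lines that they cross.

For `‖f‖_PIC ≤ 2 M ‖f‖_BV` it suffices that the points of a convex curve, taken in order, have
variation factor at most `2`, so that `pvar f c ≤ 2 var f`
(`ConvexCurve.pvar_le_two_mul_variation`). Three crossings of a line would give three points of the
curve on the line, which the curve leaves in between. One of these points lies strictly between the
other two in the plane, and its supporting line is then the given line. Moving along the curve from
it to a point off the line without meeting the other two, the curve would have to enter the
interior of a triangle with vertices on the curve, which supporting lines forbid
(`ConvexCurve.end_mem_uIcc_of_between`).

For the other inequality, split the segments of a list `S` into those with both ends on a common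
component and the rest.

* A gap in the parameter interval of a projectable component is separated by a line
  (`ConvexCurve.exists_separating_line`): if the curve is not a segment, it stays on one side of
  its chord, and the line from the midpoint of the chord to a point of the curve meets the curve
  nowhere else. Hence at most `vf S` segments cover any gap of the curve, and the segments within a
  component contribute at most `vf S * pvar f c` (`ConvexCurve.sum_enorm_sub_le`).
* A segment without a common component has an end inside and an end outside of a polygon other than
  a fixed one. As a polygon is the intersection of the half-planes of its sides, the segment passes
  between the two sides of one of at most `(M - 1) * S(𝓜)` lines. Moved slightly outwards, such a
  line becomes a line that all segments in question cross strictly, so there are at most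
  `(M - 1) * S(𝓜) * vf S` of them, and each contributes at most twice the supremum norm
  (`Decomposition.card_le_of_no_common_component`).

Together these give `var f ≤ ∑ pvar f c_i + 2 (M - 1) S(𝓜) ‖f‖_∞`
(`Decomposition.variation_le`).
-/

namespace PolyInscribed

/-! ### Plane geometry -/

theorem real_inner_eq (u v : ℂ) : ⟪u, v⟫_ℝ = u.re * v.re + u.im * v.im := by
  simp [Complex.inner]
  ring

theorem cross_eq_inner (a z : ℂ) : cross a z = ⟪(⟨-a.im, a.re⟩ : ℂ), z⟫_ℝ := by
  rw [real_inner_eq]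
  simp only [cross]
  ring

theorem cross_lineMap (a b p q : ℂ) (r : ℝ) :
    cross a (AffineMap.lineMap p q r - b) =
      (1 - r) * cross a (p - b) + r * cross a (q - b) := by
  simp [cross, AffineMap.lineMap_apply]
  ring

theorem cross_swap_side (e f p : ℂ) : cross (e - f) (p - f) = -cross (f - e) (p - e) := by
  simp [cross]
  ring

theorem continuous_cross_sub (a b : ℂ) : Continuous fun z : ℂ => cross a (z - b) := by
  unfold cross
  fun_prop

theorem mem_line_iff_cross_eq_zero {p q : ℂ} (hpq : p ≠ q) (z : ℂ) :
    z ∈ line[ℝ, p, q] ↔ cross (q - p) (z - p) = 0 := by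
  constructor
  · intro h
    obtain ⟨r, rfl⟩ := mem_affineSpan_pair_iff_exists_lineMap_eq.1 h
    rw [cross_lineMap]
    simp [cross]
    ring_nf
    simp
  · intro h
    have hn : (q.re - p.re) ^ 2 + (q.im - p.im) ^ 2 ≠ 0 := by
      intro h0
      apply hpq
      apply Complex.ext <;> nlinarith [sq_nonneg (q.re - p.re), sq_nonneg (q.im - p.im)]
    have hz : z = AffineMap.lineMap p q (((z.re - p.re) * (q.re - p.re) +
        (z.im - p.im) * (q.im - p.im)) / ((q.re - p.re) ^ 2 + (q.im - p.im) ^ 2)) := by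
      simp only [cross, Complex.sub_re, Complex.sub_im] at h
      apply Complex.ext
      · simp only [AffineMap.lineMap_apply, vsub_eq_sub, vadd_eq_add, Complex.add_re,
          Complex.real_smul, Complex.re_ofReal_mul, Complex.sub_re]
        field_simp
        linear_combination (-(q.im - p.im)) * h
      · simp only [AffineMap.lineMap_apply, vsub_eq_sub, vadd_eq_add, Complex.add_im,
          Complex.real_smul, Complex.im_ofReal_mul, Complex.sub_im]
        field_simp
        linear_combination (q.re - p.re) * h
    rw [hz]
    exact AffineMap.lineMap_mem_affineSpan_pair _ _ _

/-- Two sides of a nondegenerate triangle meet only in their common vertex. -/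
theorem eq_of_cross_eq_zero {e f n p : ℂ} (hD : cross (f - e) (n - e) ≠ 0)
    (ha : cross (f - e) (p - e) = 0) (hb : cross (n - f) (p - f) = 0) : p = f := by
  simp only [cross, Complex.sub_re, Complex.sub_im] at hD ha hb
  apply Complex.ext
  · apply sub_eq_zero.1
    refine (mul_eq_zero.1 ?_).resolve_left hD
    linear_combination (n.re - f.re) * ha - (f.re - e.re) * hb
  · apply sub_eq_zero.1
    refine (mul_eq_zero.1 ?_).resolve_left hD
    linear_combination (n.im - f.im) * ha - (f.im - e.im) * hb

/-! ### Convex curves: position of the points -/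

namespace ConvexCurve

variable (c : ConvexCurve)

/-- A point of a convex curve is never interior to a triangle with vertices on the curve, because
of the supporting line through it. -/
theorem not_mem_interior_triangle {e f n p : ℂ} (he : e ∈ c.carrier) (hf : f ∈ c.carrier)
    (hn : n ∈ c.carrier) (hp : p ∈ c.carrier) (ha : 0 < cross (f - e) (p - e))
    (hb : 0 < cross (n - f) (p - f)) (hc : 0 < cross (e - n) (p - n)) : False := by
  obtain ⟨s, hs, rfl⟩ := hp
  obtain ⟨t₁, h₁, rfl⟩ := he
  obtain ⟨t₂, h₂, rfl⟩ := hf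
  obtain ⟨t₃, h₃, rfl⟩ := hn
  obtain ⟨u, hu, hsup⟩ := c.supporting s hs
  have k₁ := hsup t₁ h₁
  have k₂ := hsup t₂ h₂
  have k₃ := hsup t₃ h₃
  generalize c.param s = p at *
  generalize c.param t₁ = e at *
  generalize c.param t₂ = f at *
  generalize c.param t₃ = n at *
  rw [real_inner_eq] at k₁ k₂ k₃
  simp only [cross, Complex.sub_re, Complex.sub_im] at *
  -- the barycentric combination of the three vertices equals `p`
  set A := (f.re - e.re) * (p.im - e.im) - (f.im - e.im) * (p.re - e.re) with hA
  set B := (n.re - f.re) * (p.im - f.im) - (n.im - f.im) * (p.re - f.re) with hB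
  set C := (e.re - n.re) * (p.im - n.im) - (e.im - n.im) * (p.re - n.re) with hC
  have hsum : B * (u.re * (e.re - p.re) + u.im * (e.im - p.im)) +
      C * (u.re * (f.re - p.re) + u.im * (f.im - p.im)) +
      A * (u.re * (n.re - p.re) + u.im * (n.im - p.im)) = 0 := by
    rw [hA, hB, hC]; ring
  have m₁ := mul_nonneg hb.le k₁
  have m₂ := mul_nonneg hc.le k₂
  have m₃ := mul_nonneg ha.le k₃
  have z₁ : u.re * (e.re - p.re) + u.im * (e.im - p.im) = 0 :=
    (mul_eq_zero.1 (by linarith : B * _ = 0)).resolve_left hb.ne'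
  have z₂ : u.re * (f.re - p.re) + u.im * (f.im - p.im) = 0 :=
    (mul_eq_zero.1 (by linarith : C * _ = 0)).resolve_left hc.ne'
  -- two independent vectors are orthogonal to `u`
  apply hu
  apply Complex.ext
  · refine (mul_eq_zero.1 (?_ : A * _ = 0)).resolve_left ha.ne'
    rw [hA]
    linear_combination (f.im - p.im) * z₁ - (e.im - p.im) * z₂
  · refine (mul_eq_zero.1 (?_ : A * _ = 0)).resolve_left ha.ne'
    rw [hA]
    linear_combination -(f.re - p.re) * z₁ + (e.re - p.re) * z₂

theorem param_mem {t : ℝ} (ht : t ∈ Set.Icc 0 c.length) : c.param t ∈ c.carrier :=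
  Set.mem_image_of_mem _ ht

/-- A supporting line through a point strictly between two points of the curve is the line through
those two points, so the curve lies on one side of it. -/
theorem cross_nonneg_of_between {e f n p q : ℂ} {r : ℝ} (he : e ∈ c.carrier) (hf : f ∈ c.carrier)
    (hn : n ∈ c.carrier) (hp : p ∈ c.carrier) (hq : q ∈ c.carrier) (hr : r ∈ Set.Ioo (0 : ℝ) 1)
    (hpr : AffineMap.lineMap e f r = p) (hD : 0 < cross (f - e) (n - e)) :
    0 ≤ cross (f - e) (q - e) := by
  obtain ⟨s, hs, rfl⟩ := hp
  obtain ⟨t₁, h₁, rfl⟩ := he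
  obtain ⟨t₂, h₂, rfl⟩ := hf
  obtain ⟨t₃, h₃, rfl⟩ := hn
  obtain ⟨t₄, h₄, rfl⟩ := hq
  obtain ⟨u, hu, hsup⟩ := c.supporting s hs
  have k₁ := hsup t₁ h₁
  have k₂ := hsup t₂ h₂
  have k₃ := hsup t₃ h₃
  have k₄ := hsup t₄ h₄
  rw [← hpr] at k₁ k₂ k₃ k₄
  generalize c.param s = p at *
  generalize c.param t₁ = e at *
  generalize c.param t₂ = f at *
  generalize c.param t₃ = n at *
  generalize c.param t₄ = q at *
  rw [real_inner_eq] at k₁ k₂ k₃ k₄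
  simp only [cross, Complex.sub_re, Complex.sub_im, AffineMap.lineMap_apply, vsub_eq_sub,
    vadd_eq_add, Complex.add_re, Complex.add_im, Complex.real_smul, Complex.re_ofReal_mul,
    Complex.im_ofReal_mul] at *
  have w₀ : u.re * (f.re - e.re) + u.im * (f.im - e.im) = 0 := by
    have h1 : 0 ≤ -(u.re * (f.re - e.re) + u.im * (f.im - e.im)) := by
      refine nonneg_of_mul_nonneg_right (?_ : 0 ≤ r * _) hr.1
      linarith
    have h2 : 0 ≤ (u.re * (f.re - e.re) + u.im * (f.im - e.im)) := by
      refine nonneg_of_mul_nonneg_right (?_ : 0 ≤ (1 - r) * _) (sub_pos.2 hr.2)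
      linarith
    linarith
  have w₃ : 0 ≤ u.re * (n.re - e.re) + u.im * (n.im - e.im) := by
    linear_combination k₃ - r * w₀
  have w₄ : 0 ≤ u.re * (q.re - e.re) + u.im * (q.im - e.im) := by
    linear_combination k₄ - r * w₀
  set d := (f.re - e.re) ^ 2 + (f.im - e.im) ^ 2 with hd
  -- `u` is a multiple of the normal of the line
  set k := u.im * (f.re - e.re) - u.re * (f.im - e.im) with hk
  have i₃ : d * (u.re * (n.re - e.re) + u.im * (n.im - e.im)) =
      k * ((f.re - e.re) * (n.im - e.im) - (f.im - e.im) * (n.re - e.re)) := by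
    rw [hd, hk]
    linear_combination ((f.re - e.re) * (n.re - e.re) + (f.im - e.im) * (n.im - e.im)) * w₀
  have i₄ : d * (u.re * (q.re - e.re) + u.im * (q.im - e.im)) =
      k * ((f.re - e.re) * (q.im - e.im) - (f.im - e.im) * (q.re - e.re)) := by
    rw [hd, hk]
    linear_combination ((f.re - e.re) * (q.re - e.re) + (f.im - e.im) * (q.im - e.im)) * w₀
  have hdpos : 0 < d := by
    rcases (by positivity : 0 ≤ d).lt_or_eq with h | h
    · exact h
    · have h1 : f.re - e.re = 0 := by nlinarith [sq_nonneg (f.re - e.re), sq_nonneg (f.im - e.im)]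
      have h2 : f.im - e.im = 0 := by nlinarith [sq_nonneg (f.re - e.re), sq_nonneg (f.im - e.im)]
      rw [h1, h2] at hD
      simp at hD
  have hk0 : 0 ≤ k := nonneg_of_mul_nonneg_left (i₃ ▸ mul_nonneg hdpos.le w₃) hD
  have hkpos : 0 < k := by
    rcases hk0.lt_or_eq with h | h
    · exact h
    · exfalso
      apply hu
      apply Complex.ext
      · refine (mul_eq_zero.1 (?_ : d * _ = 0)).resolve_left hdpos.ne'
        rw [hd]
        linear_combination (f.re - e.re) * w₀ + (f.im - e.im) * (h.trans hk)
      · refine (mul_eq_zero.1 (?_ : d * _ = 0)).resolve_left hdpos.ne'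
        rw [hd]
        linear_combination (f.im - e.im) * w₀ - (f.re - e.re) * (h.trans hk)
  exact nonneg_of_mul_nonneg_right (i₄ ▸ mul_nonneg hdpos.le w₄) hkpos

/-- The oriented form of `end_mem_uIcc_of_between`. -/
theorem end_mem_uIcc_of_between_of_pos {z n e f r : ℝ} (hz : z ∈ Set.Icc 0 c.length)
    (hn : n ∈ Set.Icc 0 c.length) (he : e ∈ Set.Icc 0 c.length) (hf : f ∈ Set.Icc 0 c.length)
    (hr : r ∈ Set.Ioo (0 : ℝ) 1) (hzr : AffineMap.lineMap (c.param e) (c.param f) r = c.param z)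
    (hD : 0 < cross (c.param f - c.param e) (c.param n - c.param e)) :
    e ∈ Set.uIcc z n ∨ f ∈ Set.uIcc z n := by
  by_contra! hcon
  have hJ : Set.uIcc z n ⊆ Set.Icc 0 c.length :=
    Set.uIcc_subset_Icc hz hn
  set E := c.param e with hE
  set F := c.param f with hF
  set N := c.param n with hN
  -- the sub-arc from `z` to `n` is connected and avoids `E` and `F`, so it is covered by the open
  -- sets `U`, which holds the open segment from `E` to `F`, and `V`, which holds `N`; a point in
  -- both is interior to the triangle `E F N`
  have hpre : IsPreconnected (c.param '' Set.uIcc z n) :=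
    isPreconnected_uIcc.image _ (c.continuousOn.mono hJ)
  let U : Set ℂ := {p | 0 < cross (N - F) (p - F) ∧ 0 < cross (E - N) (p - N)}
  let V : Set ℂ := {p | cross (F - E) (p - E) ≠ 0 ∨ cross (N - F) (p - F) < 0 ∨
    cross (E - N) (p - N) < 0}
  have hU : IsOpen U := (isOpen_lt continuous_const (continuous_cross_sub _ _)).inter
    (isOpen_lt continuous_const (continuous_cross_sub _ _))
  have hV : IsOpen V := (isOpen_ne_fun (continuous_cross_sub _ _) continuous_const).union
    ((isOpen_lt (continuous_cross_sub _ _) continuous_const).union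
    (isOpen_lt (continuous_cross_sub _ _) continuous_const))
  have hD2 : cross (N - F) (E - F) = cross (F - E) (N - E) := by simp [cross]; ring
  have hD3 : cross (E - N) (F - N) = cross (F - E) (N - E) := by simp [cross]; ring
  have hcov : c.param '' Set.uIcc z n ⊆ U ∪ V := by
    rintro _ ⟨t, ht, rfl⟩
    by_contra hUV
    simp only [U, V, Set.mem_union, Set.mem_ofPred_eq, not_or, not_and, not_lt, not_not] at hUV
    obtain ⟨h1, h2, h3, h4⟩ := hUV
    rcases h3.lt_or_eq with h | h
    · have h5 := le_antisymm (h1 h) h4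
      refine hcon.1 (c.injOn (hJ ht) he ?_ ▸ ht)
      refine eq_of_cross_eq_zero (e := N) (n := F) (f := E) ?_ h5 h2
      rw [hD3]; exact hD.ne'
    · refine hcon.2 (c.injOn (hJ ht) hf ?_ ▸ ht)
      exact eq_of_cross_eq_zero hD.ne' h2 h.symm
  have hzU : c.param z ∈ U := by
    rw [← hzr]
    constructor
    · rw [cross_lineMap, hD2]
      simp only [sub_self, (by simp [cross] : cross (N - F) 0 = 0), mul_zero, add_zero]
      exact mul_pos (sub_pos.2 hr.2) hD
    · rw [cross_lineMap, hD3, (by simp [cross]; ring : cross (E - N) (E - N) = 0)]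
      simpa using mul_pos hr.1 hD
  have hnV : c.param n ∈ V := Or.inl hD.ne'
  obtain ⟨p, hp, hpU, hpV⟩ := hpre U V hU hV hcov
    ⟨_, Set.mem_image_of_mem _ Set.left_mem_uIcc, hzU⟩
    ⟨_, Set.mem_image_of_mem _ Set.right_mem_uIcc, hnV⟩
  have hpc : p ∈ c.carrier := Set.image_mono hJ hp
  have ha : cross (F - E) (p - E) ≠ 0 := by
    rcases hpV with h | h | h
    · exact h
    · exact absurd hpU.1 h.not_gt
    · exact absurd hpU.2 h.not_gt
  have ha' := c.cross_nonneg_of_between (c.param_mem he) (c.param_mem hf) (c.param_mem hn)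
    (c.param_mem hz) hpc hr hzr hD
  exact c.not_mem_interior_triangle (c.param_mem he) (c.param_mem hf) (c.param_mem hn) hpc
    (lt_of_le_of_ne ha' ha.symm) hpU.1 hpU.2

/-- A point of a convex curve strictly between two others cannot be joined along the curve to a
point off the line without passing through one of those two: just off the open segment, the curve
would enter the interior of a triangle with vertices on it. -/
theorem end_mem_uIcc_of_between {z n e f r : ℝ} (hz : z ∈ Set.Icc 0 c.length)
    (hn : n ∈ Set.Icc 0 c.length) (he : e ∈ Set.Icc 0 c.length) (hf : f ∈ Set.Icc 0 c.length)
    (hr : r ∈ Set.Ioo (0 : ℝ) 1) (hzr : AffineMap.lineMap (c.param e) (c.param f) r = c.param z)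
    (hD : cross (c.param f - c.param e) (c.param n - c.param e) ≠ 0) :
    e ∈ Set.uIcc z n ∨ f ∈ Set.uIcc z n := by
  rcases hD.lt_or_gt with h | h
  · refine (c.end_mem_uIcc_of_between_of_pos hz hn hf he (r := 1 - r) ⟨by linarith [hr.2],
      by linarith [hr.1]⟩ ?_ ?_).symm
    · rw [AffineMap.lineMap_apply_one_sub, hzr]
    · rw [cross_swap_side]; linarith
  · exact c.end_mem_uIcc_of_between_of_pos hz hn he hf hr hzr h

/-- The form of `end_mem_uIcc_of_between` for points on and off a given line. -/
theorem end_mem_uIcc_of_wbtw {z n e f : ℝ} (hz : z ∈ Set.Icc 0 c.length)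
    (hn : n ∈ Set.Icc 0 c.length) (he : e ∈ Set.Icc 0 c.length) (hf : f ∈ Set.Icc 0 c.length)
    (hze : z ≠ e) (hzf : z ≠ f) (hw : Wbtw ℝ (c.param e) (c.param z) (c.param f))
    {ℓ : AffineSubspace ℝ ℂ} (heℓ : c.param e ∈ ℓ) (hfℓ : c.param f ∈ ℓ) (hnℓ : c.param n ∉ ℓ) :
    e ∈ Set.uIcc z n ∨ f ∈ Set.uIcc z n := by
  obtain ⟨r, hr, hzr⟩ := hw
  have hr0 : r ≠ 0 := by
    rintro rfl
    rw [AffineMap.lineMap_apply_zero] at hzr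
    exact hze (c.injOn hz he hzr.symm)
  have hr1 : r ≠ 1 := by
    rintro rfl
    rw [AffineMap.lineMap_apply_one] at hzr
    exact hzf (c.injOn hz hf hzr.symm)
  refine c.end_mem_uIcc_of_between hz hn he hf
    ⟨lt_of_le_of_ne hr.1 hr0.symm, lt_of_le_of_ne hr.2 hr1⟩ hzr fun h0 => hnℓ ?_
  have hef : c.param e ≠ c.param f := by
    intro h
    rw [h] at hzr
    simp only [AffineMap.lineMap_same, AffineMap.const_apply] at hzr
    exact hzf (c.injOn hz hf hzr.symm)
  exact affineSpan_pair_le_of_mem_of_mem heℓ hfℓ ((mem_line_iff_cross_eq_zero hef _).2 h0)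

/-- A convex curve cannot meet a line three times, leaving it in between. -/
theorem not_three_hits {z₁ n₁ z₂ n₂ z₃ : ℝ} (h₀ : 0 ≤ z₁) (h₁ : z₁ < n₁) (h₂ : n₁ < z₂)
    (h₃ : z₂ < n₂) (h₄ : n₂ < z₃) (h₅ : z₃ ≤ c.length) {ℓ : AffineSubspace ℝ ℂ} (hℓ : IsLine ℓ)
    (k₁ : c.param z₁ ∈ ℓ) (k₂ : c.param z₂ ∈ ℓ) (k₃ : c.param z₃ ∈ ℓ)
    (m₁ : c.param n₁ ∉ ℓ) (m₂ : c.param n₂ ∉ ℓ) : False := by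
  obtain ⟨p, q, hpq, rfl⟩ := hℓ
  have hz₁ : z₁ ∈ Set.Icc 0 c.length := ⟨by linarith, by linarith⟩
  have hz₂ : z₂ ∈ Set.Icc 0 c.length := ⟨by linarith, by linarith⟩
  have hz₃ : z₃ ∈ Set.Icc 0 c.length := ⟨by linarith, by linarith⟩
  have hn₁ : n₁ ∈ Set.Icc 0 c.length := ⟨by linarith, by linarith⟩
  have hn₂ : n₂ ∈ Set.Icc 0 c.length := ⟨by linarith, by linarith⟩
  rcases (collinear_triple_of_mem_affineSpan_pair k₁ k₂ k₃).wbtw_or_wbtw_or_wbtw with h | h | h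
  · rcases c.end_mem_uIcc_of_wbtw hz₂ hn₂ hz₁ hz₃ (by linarith) (by linarith) h k₁ k₃ m₂
      with h' | h' <;> rw [Set.uIcc_of_le h₃.le] at h' <;> linarith [h'.1, h'.2]
  · rcases c.end_mem_uIcc_of_wbtw hz₃ hn₂ hz₂ hz₁ (by linarith) (by linarith) h k₂ k₁ m₂
      with h' | h' <;> rw [Set.uIcc_of_ge h₄.le] at h' <;> linarith [h'.1, h'.2]
  · rcases c.end_mem_uIcc_of_wbtw hz₁ hn₁ hz₃ hz₂ (by linarith) (by linarith) h k₃ k₂ m₁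
      with h' | h' <;> rw [Set.uIcc_of_le h₁.le] at h' <;> linarith [h'.1, h'.2]

end ConvexCurve

/-! ### Crossings of a convex curve with a line -/

namespace ConvexCurve

variable (c : ConvexCurve)

theorem exists_param_mem_Ioo_of_sOppSide {s t : ℝ} (h0 : 0 ≤ s) (hst : s < t) (hL : t ≤ c.length)
    {ℓ : AffineSubspace ℝ ℂ} (hℓ : IsLine ℓ) (h : ℓ.SOppSide (c.param s) (c.param t)) :
    ∃ z ∈ Set.Ioo s t, c.param z ∈ ℓ := by
  obtain ⟨p, q, hpq, rfl⟩ := hℓ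
  obtain ⟨hw, hs, ht⟩ := h
  obtain ⟨y, hy, r, hr, rfl⟩ := AffineSubspace.wOppSide_iff_exists_wbtw.1 hw
  rw [mem_line_iff_cross_eq_zero hpq] at hs ht hy
  rw [cross_lineMap] at hy
  have hcont : ContinuousOn (fun t => cross (q - p) (c.param t - p)) (Set.Icc s t) :=
    (continuous_cross_sub _ _).comp_continuousOn
      (c.continuousOn.mono (Set.Icc_subset_Icc h0 hL))
  have hmem : (0 : ℝ) ∈ (fun t => cross (q - p) (c.param t - p)) '' Set.Icc s t := by
    have hr1 : 0 ≤ 1 - r := sub_nonneg.2 hr.2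
    rcases lt_or_gt_of_ne hs with h1 | h1 <;> rcases lt_or_gt_of_ne ht with h2 | h2
    · rcases hr.1.eq_or_lt with rfl | h3
      · linarith
      · linarith [mul_neg_of_pos_of_neg h3 h2, mul_nonpos_of_nonneg_of_nonpos hr1 h1.le]
    · exact intermediate_value_Icc hst.le hcont ⟨h1.le, h2.le⟩
    · exact intermediate_value_Icc' hst.le hcont ⟨h2.le, h1.le⟩
    · rcases hr.1.eq_or_lt with rfl | h3
      · linarith
      · linarith [mul_pos h3 h2, mul_nonneg hr1 h1.le]
  obtain ⟨z, hz, hz0⟩ := hmem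
  refine ⟨z, ⟨lt_of_le_of_ne hz.1 ?_, lt_of_le_of_ne hz.2 ?_⟩,
    (mem_line_iff_cross_eq_zero hpq _).2 hz0⟩
  · rintro rfl
    exact hs hz0
  · rintro rfl
    exact ht hz0

/-- A line has at most two crossing segments on a list of points in order along a convex curve. -/
theorem crossingCount_le_two {n : ℕ} {t : ℕ → ℝ} (hmem : ∀ i, t i ∈ Set.Icc 0 c.length)
    (hlt : ∀ i < n, t i < t (i + 1)) {ℓ : AffineSubspace ℝ ℂ} (hℓ : IsLine ℓ) :
    crossingCount ℓ n (fun i => c.param (t i)) ≤ 2 := by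
  classical
  unfold crossingCount
  split_ifs with h0 h1
  · norm_num
  · norm_num
  by_contra! hcard
  set T := (Finset.range n).filter (fun i => IsCrossing ℓ (fun i => c.param (t i)) i) with hT
  let e := T.orderEmbOfFin rfl
  have hmono : ∀ i ≤ n, ∀ j ≤ i, t j ≤ t i := by
    intro i hi
    induction i with
    | zero => intro j hj; rw [Nat.le_zero.1 hj]
    | succ i ih =>
      intro j hj
      rcases Nat.le_succ_iff.1 hj with h | h
      · exact (ih (by omega) j h).trans (hlt i (by omega)).le
      · rw [h]
  obtain ⟨i, j, k, hi, hj, hk, hij, hjk⟩ : ∃ i j k, i ∈ T ∧ j ∈ T ∧ k ∈ T ∧ i < j ∧ j < k :=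
    ⟨e ⟨0, by omega⟩, e ⟨1, by omega⟩, e ⟨2, by omega⟩, T.orderEmbOfFin_mem _ _,
      T.orderEmbOfFin_mem _ _, T.orderEmbOfFin_mem _ _, e.strictMono (by simp),
      e.strictMono (by simp)⟩
  simp only [hT, Finset.mem_filter, Finset.mem_range] at hi hj hk
  have hfirst : ∀ i < n, IsCrossing ℓ (fun i => c.param (t i)) i →
      ∃ z, t i ≤ z ∧ z ≤ t (i + 1) ∧ c.param z ∈ ℓ := by
    rintro i hi (h | ⟨-, h⟩ | ⟨-, h⟩)
    · obtain ⟨z, hz, hzℓ⟩ := c.exists_param_mem_Ioo_of_sOppSide (hmem i).1 (hlt i hi)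
        (hmem (i + 1)).2 hℓ h
      exact ⟨z, hz.1.le, hz.2.le, hzℓ⟩
    · exact ⟨_, le_rfl, (hlt i hi).le, h⟩
    · exact ⟨_, (hlt i hi).le, le_rfl, h⟩
  -- a crossing segment other than the first one starts off the line
  have hlater : ∀ i < n, 0 < i → IsCrossing ℓ (fun i => c.param (t i)) i →
      c.param (t i) ∉ ℓ := by
    rintro i - hi0 (h | ⟨h, -⟩ | ⟨h, -⟩)
    · exact h.2.1
    · omega
    · exact h
  obtain ⟨z₁, h₁, h₁', hz₁⟩ := hfirst i hi.1 hi.2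
  obtain ⟨z₂, h₂, h₂', hz₂⟩ := hfirst j hj.1 hj.2
  obtain ⟨z₃, h₃, h₃', hz₃⟩ := hfirst k hk.1 hk.2
  have m₂ := hlater j hj.1 (by omega) hj.2
  have m₃ := hlater k hk.1 (by omega) hk.2
  have l₁ := hmono j (by omega) (i + 1) (by omega)
  have l₂ := hmono k (by omega) (j + 1) (by omega)
  have ne : ∀ {a b : ℝ}, c.param a ∈ ℓ → c.param b ∉ ℓ → a ≠ b := by
    rintro a b ha hb rfl
    exact hb ha
  refine c.not_three_hits ((hmem i).1.trans h₁) (lt_of_le_of_ne (h₁'.trans l₁) (ne hz₁ m₂))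
    (lt_of_le_of_ne h₂ (ne hz₂ m₂).symm) (lt_of_le_of_ne (h₂'.trans l₂) (ne hz₂ m₃))
    (lt_of_le_of_ne h₃ (ne hz₃ m₃).symm) (h₃'.trans (hmem _).2) hℓ hz₁ hz₂ hz₃ m₂ m₃

end ConvexCurve

/-! ### Parametrized variation is bounded by two-dimensional variation -/

/-- Repetitions can be deleted from a monotone list without changing the variation over it. -/
theorem exists_strict_of_monotone {α E : Type*} [LinearOrder α] [PseudoEMetricSpace E] (F : α → E)
    {u : ℕ → α} (hu : Monotone u) (n : ℕ) :
    ∃ (m : ℕ) (v : ℕ → α), (∀ i < m, v i < v (i + 1)) ∧ v m = u n ∧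
      ∑ i ∈ Finset.range m, edist (F (v (i + 1))) (F (v i)) =
        ∑ i ∈ Finset.range n, edist (F (u (i + 1))) (F (u i)) := by
  induction n with
  | zero => exact ⟨0, u, by simp, rfl, by simp⟩
  | succ n ih =>
    obtain ⟨m, v, hv, hvm, hsum⟩ := ih
    rcases (hu n.le_succ).lt_or_eq with h | h
    · refine ⟨m + 1, fun i => if i ≤ m then v i else u (n + 1), ?_, by simp, ?_⟩
      · intro i hi
        rcases (Nat.lt_succ_iff.1 hi).lt_or_eq with h' | rfl
        · simpa [h'.le, Nat.succ_le_of_lt h'] using hv i h'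
        · simpa [hvm] using h
      · rw [Finset.sum_range_succ, Finset.sum_range_succ, ← hsum]
        congr 1
        · refine Finset.sum_congr rfl fun i hi => ?_
          have := Finset.mem_range.1 hi
          simp [this.le, Nat.succ_le_of_lt this]
        · simp [hvm]
    · refine ⟨m, v, hv, hvm.trans h, ?_⟩
      rw [Finset.sum_range_succ, ← hsum, h]
      simp

theorem ConvexCurve.pvar_le_two_mul_variation (c : ConvexCurve) {σ : Set ℂ} (h : c.carrier ⊆ σ)
    (f : σ → ℂ) : c.pvar (f ∘ Set.inclusion h) ≤ 2 * variation f := by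
  unfold ConvexCurve.pvar eVariationOn
  refine iSup_le fun p => ?_
  obtain ⟨n, u, hu, -⟩ := p
  obtain ⟨m, v, hv, -, hsum⟩ := exists_strict_of_monotone
    (fun t : Set.Icc (0 : ℝ) c.length => (f ∘ Set.inclusion h) ⟨c.param t, c.param_mem t.2⟩) hu n
  refine hsum.symm.trans_le ?_
  let x : ℕ → σ := fun i => ⟨c.param (v i), h (c.param_mem (v i).2)⟩
  have hx : ∀ i < m, x i ≠ x (i + 1) := by
    intro i hi hxi
    exact (hv i hi).ne (Subtype.ext (c.injOn (v i).2 (v (i + 1)).2 (congrArg Subtype.val hxi)))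
  have hvf : variationFactor m (fun i => (x i : ℂ)) ≤ 2 := by
    refine iSup₂_le fun ℓ hℓ => ?_
    exact_mod_cast c.crossingCount_le_two (fun i => (v i).2) (fun i hi => hv i hi) hℓ
  have hvar : curveVariation f m x / variationFactor m (fun i => (x i : ℂ)) ≤ variation f :=
    le_iSup_of_le m (le_iSup_of_le x (le_iSup_of_le hx le_rfl))
  have hle : ∑ i ∈ Finset.range m, edist ((f ∘ Set.inclusion h) ⟨c.param (v (i + 1)),
      c.param_mem (v (i + 1)).2⟩) ((f ∘ Set.inclusion h) ⟨c.param (v i), c.param_mem (v i).2⟩) =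
      curveVariation f m x :=
    Finset.sum_congr rfl fun i _ => edist_eq_enorm_sub _ _
  rw [hle, mul_comm]
  rw [← ENNReal.div_le_iff (by norm_num) (by norm_num)]
  exact (ENNReal.div_le_div_left hvf _).trans hvar

/-! ### Separation of the arcs of a projectable convex curve -/

namespace ConvexCurve

variable (c : ConvexCurve)

theorem param_zero_ne_param_length : c.param 0 ≠ c.param c.length := fun h =>
  c.length_pos.ne (c.injOn ⟨le_rfl, c.length_pos.le⟩ ⟨c.length_pos.le, le_rfl⟩ h)

/-- If a projectable convex curve meets the line through its endpoints in a third point, then it is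
contained in that line: projectability puts that point strictly between the endpoints. -/
theorem cross_eq_zero_of_isProjectable (hc : c.IsProjectable) {m n : ℝ}
    (hm : m ∈ Set.Ioo 0 c.length) (hn : n ∈ Set.Icc 0 c.length)
    (h : cross (c.param c.length - c.param 0) (c.param m - c.param 0) = 0) :
    cross (c.param c.length - c.param 0) (c.param n - c.param 0) = 0 := by
  have hmL : c.param m ∈ line[ℝ, c.source, c.target] :=
    (mem_line_iff_cross_eq_zero c.param_zero_ne_param_length _).2 h
  have hmI : m ∈ Set.Icc 0 c.length := Set.Ioo_subset_Icc_self hm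
  have hseg : c.param m ∈ segment ℝ c.source c.target := by
    rw [← hc]
    exact ⟨_, c.param_mem hmI, EuclideanGeometry.orthogonalProjection_eq_self_iff.2 hmL⟩
  have h0 : (0 : ℝ) ∈ Set.Icc 0 c.length := ⟨le_rfl, c.length_pos.le⟩
  have hL : c.length ∈ Set.Icc 0 c.length := ⟨c.length_pos.le, le_rfl⟩
  by_contra hne
  have hnl : c.param n ∉ line[ℝ, c.source, c.target] := fun h' =>
    hne ((mem_line_iff_cross_eq_zero c.param_zero_ne_param_length _).1 h')
  have hn0 : n ≠ 0 := by
    rintro rfl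
    exact hnl (left_mem_affineSpan_pair _ _ _)
  have hnL : n ≠ c.length := by
    rintro rfl
    exact hnl (right_mem_affineSpan_pair _ _ _)
  have hn' : n ∈ Set.Ioo 0 c.length := ⟨lt_of_le_of_ne hn.1 hn0.symm, lt_of_le_of_ne hn.2 hnL⟩
  have hsub : Set.uIcc m n ⊆ Set.Ioo 0 c.length :=
    Set.ordConnected_Ioo.uIcc_subset hm hn'
  rcases c.end_mem_uIcc_of_wbtw hmI hn h0 hL hm.1.ne' hm.2.ne (mem_segment_iff_wbtw.1 hseg)
    (left_mem_affineSpan_pair _ _ _) (right_mem_affineSpan_pair _ _ _) hnl with h' | h'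
  · exact (hsub h').1.ne rfl
  · exact (hsub h').2.ne rfl

/-- A ray from the midpoint of a chord meets the part of a convex curve on one side of that chord
only once. -/
theorem eq_of_ray_midpoint {e f q n : ℂ} (he : e ∈ c.carrier) (hf : f ∈ c.carrier)
    (hq : q ∈ c.carrier) (hn : n ∈ c.carrier) (hqpos : 0 < cross (f - e) (q - e))
    (hnpos : 0 < cross (f - e) (n - e))
    (h : cross (q - midpoint ℝ e f) (n - midpoint ℝ e f) = 0) : q = n := by
  set d := cross (f - e) (q - e) with hd
  set k := cross (f - e) (n - e) with hk
  have hre : (midpoint ℝ e f).re = (e.re + f.re) / 2 := by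
    simp [midpoint_eq_smul_add]; ring
  have him : (midpoint ℝ e f).im = (e.im + f.im) / 2 := by
    simp [midpoint_eq_smul_add]; ring
  simp only [cross, Complex.sub_re, Complex.sub_im, hre, him] at h hd hk
  have i₁ : d * cross (n - f) (q - f) = (k - d) * d / 2 := by
    simp only [cross, Complex.sub_re, Complex.sub_im]
    rw [hd, hk]
    linear_combination (-((f.re - e.re) * (q.im - e.im) - (f.im - e.im) * (q.re - e.re))) * h
  have i₂ : d * cross (e - n) (q - n) = (k - d) * d / 2 := by
    simp only [cross, Complex.sub_re, Complex.sub_im]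
    rw [hd, hk]
    linear_combination (((f.re - e.re) * (q.im - e.im) - (f.im - e.im) * (q.re - e.re))) * h
  have i₃ : k * cross (q - f) (n - f) = (d - k) * k / 2 := by
    simp only [cross, Complex.sub_re, Complex.sub_im]
    rw [hd, hk]
    linear_combination (((f.re - e.re) * (n.im - e.im) - (f.im - e.im) * (n.re - e.re))) * h
  have i₄ : k * cross (e - q) (n - q) = (d - k) * k / 2 := by
    simp only [cross, Complex.sub_re, Complex.sub_im]
    rw [hd, hk]
    linear_combination (-((f.re - e.re) * (n.im - e.im) - (f.im - e.im) * (n.re - e.re))) * h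
  rcases lt_trichotomy d k with hlt | heq | hgt
  · exfalso
    have := mul_pos (sub_pos.2 hlt) hqpos
    exact c.not_mem_interior_triangle he hf hn hq hqpos
      (pos_of_mul_pos_right (by linarith : 0 < d * _) hqpos.le)
      (pos_of_mul_pos_right (by linarith : 0 < d * _) hqpos.le)
  · apply Complex.ext
    · apply sub_eq_zero.1
      refine (mul_eq_zero.1 (?_ : d * _ = 0)).resolve_left hqpos.ne'
      rw [hd]
      rw [hd, hk] at heq
      linear_combination (f.re - e.re) * h + (q.re - (e.re + f.re) / 2) * heq
    · apply sub_eq_zero.1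
      refine (mul_eq_zero.1 (?_ : d * _ = 0)).resolve_left hqpos.ne'
      rw [hd]
      rw [hd, hk] at heq
      linear_combination (f.im - e.im) * h + (q.im - (e.im + f.im) / 2) * heq
  · exfalso
    have := mul_pos (sub_pos.2 hgt) hnpos
    exact c.not_mem_interior_triangle he hf hq hn hnpos
      (pos_of_mul_pos_right (by linarith : 0 < k * _) hnpos.le)
      (pos_of_mul_pos_right (by linarith : 0 < k * _) hnpos.le)

/-- If a line misses the curve except perhaps for its endpoints, then the rest of the curve is on
one side of it. -/
theorem cross_mul_cross_pos {m n : ℝ} (hm : m ∈ Set.Ioo 0 c.length) (hn : n ∈ Set.Ioo 0 c.length)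
    {a b : ℂ} (h : ∀ t ∈ Set.Ioo 0 c.length, cross a (c.param t - b) ≠ 0) :
    0 < cross a (c.param m - b) * cross a (c.param n - b) := by
  have hcont : ContinuousOn (fun t => cross a (c.param t - b)) (Set.Ioo 0 c.length) :=
    (continuous_cross_sub _ _).comp_continuousOn (c.continuousOn.mono Set.Ioo_subset_Icc_self)
  by_contra! hle
  have hmem : (0 : ℝ) ∈ (fun t => cross a (c.param t - b)) '' Set.Ioo 0 c.length := by
    rcases lt_or_gt_of_ne (h m hm) with h1 | h1 <;> rcases lt_or_gt_of_ne (h n hn) with h2 | h2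
    · nlinarith
    · exact isPreconnected_Ioo.intermediate_value hm hn hcont ⟨h1.le, h2.le⟩
    · exact isPreconnected_Ioo.intermediate_value hn hm hcont ⟨h2.le, h1.le⟩
    · nlinarith
  obtain ⟨z, hz, hz0⟩ := hmem
  exact h z hz hz0

/-- Every point cuts a projectable convex curve into two arcs on opposite sides of a line. If the
curve is a segment, the line is perpendicular to it; otherwise it joins the given point to the
midpoint of the endpoints. -/
theorem exists_line_through (hc : c.IsProjectable) {m : ℝ} (hm : m ∈ Set.Ioo 0 c.length) :
    ∃ u : ℂ, (∀ t ∈ Set.Ico 0 m, ⟪u, c.param t⟫_ℝ < ⟪u, c.param m⟫_ℝ) ∧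
      ∀ t ∈ Set.Ioc m c.length, ⟪u, c.param m⟫_ℝ < ⟪u, c.param t⟫_ℝ := by
  have hmI := Set.Ioo_subset_Icc_self hm
  have h0 : (0 : ℝ) ∈ Set.Icc 0 c.length := ⟨le_rfl, c.length_pos.le⟩
  have hL : c.length ∈ Set.Icc 0 c.length := ⟨c.length_pos.le, le_rfl⟩
  -- by the intermediate value theorem it suffices that the functional separates the endpoints and
  -- takes its value at `m` only once
  suffices H : ∃ u : ℂ, (∀ t ∈ Set.Icc 0 c.length, ⟪u, c.param t⟫_ℝ = ⟪u, c.param m⟫_ℝ → t = m) ∧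
      ⟪u, c.param 0⟫_ℝ < ⟪u, c.param m⟫_ℝ ∧ ⟪u, c.param m⟫_ℝ < ⟪u, c.param c.length⟫_ℝ by
    obtain ⟨u, huniq, hlt, hgt⟩ := H
    have hcont : ContinuousOn (fun t => ⟪u, c.param t⟫_ℝ) (Set.Icc 0 c.length) :=
      continuousOn_const.inner c.continuousOn
    refine ⟨u, fun t ht => ?_, fun t ht => ?_⟩
    · by_contra! hle
      have htI : t ∈ Set.Icc 0 c.length := ⟨ht.1, ht.2.le.trans hmI.2⟩
      obtain ⟨z, hz, hzm⟩ := intermediate_value_Icc ht.1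
        (hcont.mono (Set.Icc_subset_Icc_right htI.2)) ⟨hlt.le, hle⟩
      have := huniq z ⟨hz.1, hz.2.trans htI.2⟩ hzm
      linarith [hz.2, ht.2]
    · by_contra! hle
      have htI : t ∈ Set.Icc 0 c.length := ⟨hmI.1.trans ht.1.le, ht.2⟩
      obtain ⟨z, hz, hzm⟩ := intermediate_value_Icc ht.2
        (hcont.mono (Set.Icc_subset_Icc_left htI.1)) ⟨hle, hgt.le⟩
      have := huniq z ⟨htI.1.trans hz.1, hz.2⟩ hzm
      linarith [hz.1, ht.1]
  by_cases hcol : ∀ t ∈ Set.Icc 0 c.length,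
      cross (c.param c.length - c.param 0) (c.param t - c.param 0) = 0
  · have hinj : Set.InjOn (fun t => ⟪c.param c.length - c.param 0, c.param t⟫_ℝ)
        (Set.Icc 0 c.length) := by
      intro s hs t ht hst
      refine c.injOn hs ht ?_
      have h1 := hcol s hs
      have h2 := hcol t ht
      have hne : (c.param c.length - c.param 0) ≠ 0 := sub_ne_zero.2 c.param_zero_ne_param_length.symm
      simp only [real_inner_eq] at hst
      rw [← sub_eq_zero, ← Complex.normSq_eq_zero, ← mul_eq_zero_iff_left
        (Complex.normSq_eq_zero.not.2 hne)]
      simp only [cross, Complex.normSq_apply, Complex.sub_re, Complex.sub_im] at *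
      generalize (c.param c.length).re = a at *
      generalize (c.param c.length).im = b at *
      have k1 : (a - (c.param 0).re) * ((c.param s).re - (c.param t).re) +
          (b - (c.param 0).im) * ((c.param s).im - (c.param t).im) = 0 := by linarith
      have k2 : (a - (c.param 0).re) * ((c.param s).im - (c.param t).im) -
          (b - (c.param 0).im) * ((c.param s).re - (c.param t).re) = 0 := by linarith
      linear_combination ((a - (c.param 0).re) * ((c.param s).re - (c.param t).re) +
          (b - (c.param 0).im) * ((c.param s).im - (c.param t).im)) * k1 +
          ((a - (c.param 0).re) * ((c.param s).im - (c.param t).im) -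
          (b - (c.param 0).im) * ((c.param s).re - (c.param t).re)) * k2
    have hcont : ContinuousOn (fun t => ⟪c.param c.length - c.param 0, c.param t⟫_ℝ)
        (Set.Icc 0 c.length) := continuousOn_const.inner c.continuousOn
    rcases hcont.strictMonoOn_of_injOn_Icc' c.length_pos.le hinj with hmono | hanti
    · exact ⟨_, fun t ht h => hinj ht hmI h, hmono h0 hmI hm.1, hmono hmI hL hm.2⟩
    · refine ⟨-(c.param c.length - c.param 0), fun t ht h => hinj ht hmI ?_, ?_, ?_⟩
      · simpa only [inner_neg_left, neg_inj] using h
      · simpa only [inner_neg_left, neg_lt_neg_iff] using hanti h0 hmI hm.1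
      · simpa only [inner_neg_left, neg_lt_neg_iff] using hanti hmI hL hm.2
  · push Not at hcol
    obtain ⟨n, hn, hne⟩ := hcol
    have hoff : ∀ t ∈ Set.Ioo 0 c.length,
        cross (c.param c.length - c.param 0) (c.param t - c.param 0) ≠ 0 := fun t ht h =>
      hne (c.cross_eq_zero_of_isProjectable hc ht hn h)
    set E := c.param 0 with hE
    set F := c.param c.length with hF
    set Q := c.param m with hQ
    set P := midpoint ℝ E F with hP
    have hre : P.re = (E.re + F.re) / 2 := by
      simp [hP, midpoint_eq_smul_add]; ring
    have him : P.im = (E.im + F.im) / 2 := by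
      simp [hP, midpoint_eq_smul_add]; ring
    -- the ends are at opposite distances from the line through the midpoint
    have hE' : cross (Q - P) (E - P) = cross (F - E) (Q - E) / 2 := by
      simp only [cross, Complex.sub_re, Complex.sub_im, hre, him]; ring
    have hF' : cross (Q - P) (F - P) = -(cross (F - E) (Q - E) / 2) := by
      simp only [cross, Complex.sub_re, Complex.sub_im, hre, him]; ring
    have huniq : ∀ t ∈ Set.Icc 0 c.length, cross (Q - P) (c.param t - P) = 0 → t = m := by
      intro t ht h
      have hQne := hoff m hm
      rw [← hQ] at hQne
      have ht0 : t ≠ 0 := by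
        rintro rfl
        rw [← hE, hE'] at h
        exact hQne (by linarith)
      have htL : t ≠ c.length := by
        rintro rfl
        rw [← hF, hF'] at h
        exact hQne (by linarith)
      have ht' : t ∈ Set.Ioo 0 c.length :=
        ⟨lt_of_le_of_ne ht.1 ht0.symm, lt_of_le_of_ne ht.2 htL⟩
      have hpos := c.cross_mul_cross_pos hm ht' hoff
      rw [← hQ] at hpos
      refine (c.injOn hmI ht ?_).symm
      rcases lt_or_gt_of_ne hQne with h1 | h1
      · refine c.eq_of_ray_midpoint (c.param_mem hL) (c.param_mem h0) (c.param_mem hmI)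
          (c.param_mem ht) ?_ ?_ ?_
        · rw [cross_swap_side]; linarith
        · rw [cross_swap_side]
          exact neg_pos.2 (neg_of_mul_pos_right hpos h1.le)
        · rw [midpoint_comm]; exact h
      · exact c.eq_of_ray_midpoint (c.param_mem h0) (c.param_mem hL) (c.param_mem hmI)
          (c.param_mem ht) h1 (pos_of_mul_pos_right hpos h1.le) h
    obtain ⟨w, hw⟩ : ∃ w : ℂ, ∀ z, ⟪w, z⟫_ℝ = cross (Q - P) (z - P) + cross (Q - P) P :=
      ⟨⟨-(Q - P).im, (Q - P).re⟩, fun z => by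
        rw [← cross_eq_inner]; simp [cross]; ring⟩
    have hQ0 : cross (Q - P) (Q - P) = 0 := by simp [cross]; ring
    rcases lt_or_gt_of_ne (hoff m hm) with h1 | h1 <;> rw [← hQ] at h1
    · refine ⟨w, fun t ht h => huniq t ht ?_, ?_, ?_⟩
      · rw [hw, hw, hQ0] at h; linarith
      · rw [hw, hw, hQ0, hE']; linarith
      · rw [hw, hw, hQ0, hF']; linarith
    · refine ⟨-w, fun t ht h => huniq t ht ?_, ?_, ?_⟩
      · rw [inner_neg_left, inner_neg_left, hw, hw, hQ0] at h; linarith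
      · rw [inner_neg_left, inner_neg_left, hw, hw, hQ0, hE']; linarith
      · rw [inner_neg_left, inner_neg_left, hw, hw, hQ0, hF']; linarith

/-- Two disjoint sub-arcs of a projectable convex curve, one following the other, are strictly
separated by a line. -/
theorem exists_separating_line (hc : c.IsProjectable) {s t : ℝ} (hs : 0 ≤ s) (hst : s < t)
    (ht : t ≤ c.length) : ∃ (u : ℂ) (r : ℝ), (∀ a ∈ Set.Icc 0 s, ⟪u, c.param a⟫_ℝ < r) ∧
      ∀ b ∈ Set.Icc t c.length, r < ⟪u, c.param b⟫_ℝ := by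
  obtain ⟨u, h1, h2⟩ := c.exists_line_through hc (m := (s + t) / 2)
    ⟨by linarith, by linarith⟩
  exact ⟨u, _, fun a ha => h1 a ⟨ha.1, by linarith [ha.2]⟩,
    fun b hb => h2 b ⟨by linarith [hb.1], hb.2⟩⟩

end ConvexCurve

/-! ### Convex polygons as intersections of half-planes -/

/-- A point in a positively oriented triangle, given by its three oriented areas, lies in the
convex hull of the vertices. -/
theorem mem_convexHull_triangle {e f n z : ℂ} {s : Set ℂ} (he : e ∈ s)
    (hf : f ∈ s) (hn : n ∈ s) (hD : 0 < cross (f - e) (n - e)) (ha : 0 ≤ cross (f - e) (z - e))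
    (hb : 0 ≤ cross (n - f) (z - f)) (hc : 0 ≤ cross (e - n) (z - n)) : z ∈ convexHull ℝ s := by
  set D := cross (f - e) (n - e) with hD'
  set A := cross (f - e) (z - e) with hA
  set B := cross (n - f) (z - f) with hB
  set C := cross (e - n) (z - n) with hC
  simp only [cross, Complex.sub_re, Complex.sub_im] at hD' hA hB hC
  have hsum : B / D + C / D + A / D = 1 := by
    field_simp
    rw [hD', hA, hB, hC]; ring
  have hz : z = (B / D) • e + (C / D) • f + (A / D) • n := by
    apply Complex.ext
    · simp only [Complex.add_re, Complex.real_smul, Complex.re_ofReal_mul]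
      field_simp
      rw [hD', hA, hB, hC]; ring
    · simp only [Complex.add_im, Complex.real_smul, Complex.im_ofReal_mul]
      field_simp
      rw [hD', hA, hB, hC]; ring
  rw [hz]
  have hconv := convex_convexHull ℝ s
  have := hconv.sum_mem (t := Finset.univ) (w := ![B / D, C / D, A / D]) (z := ![e, f, n])
    (by intro i _; fin_cases i <;> simp <;> positivity)
    (by simpa [Fin.sum_univ_three] using hsum)
    (by
      intro i _
      fin_cases i
      · exact subset_convexHull ℝ s he
      · exact subset_convexHull ℝ s hf
      · exact subset_convexHull ℝ s hn)
  simpa [Fin.sum_univ_three] using this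

namespace ConvexPolygon

variable (P : ConvexPolygon)

theorem cross_nonneg_of_mem {z : ℂ} (hz : z ∈ P.carrier) (k : Fin (P.extra + 3)) :
    0 ≤ cross (P.vertex (k + 1) - P.vertex k) (z - P.vertex k) := by
  have hconv : Convex ℝ {z | 0 ≤ cross (P.vertex (k + 1) - P.vertex k) (z - P.vertex k)} := by
    have : {z | 0 ≤ cross (P.vertex (k + 1) - P.vertex k) (z - P.vertex k)} =
        {z | cross (P.vertex (k + 1) - P.vertex k) (P.vertex k) ≤
          cross (P.vertex (k + 1) - P.vertex k) z} := by
      ext z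
      simp only [cross, Set.mem_ofPred_eq, Complex.sub_re, Complex.sub_im]
      constructor <;> intro h <;> linarith
    rw [this]
    exact convex_halfSpace_ge (f := fun z => cross (P.vertex (k + 1) - P.vertex k) z)
      ⟨fun x y => by simp [cross]; ring, fun r x => by simp [cross]; ring⟩ _
  refine convexHull_min ?_ hconv hz
  rintro _ ⟨j, rfl⟩
  by_cases h1 : j = k
  · subst h1
    simp [cross]
  by_cases h2 : j = k + 1
  · subst h2
    simp [cross]
    ring_nf
    rfl
  exact (P.left_of_side k j h1 h2).le

/-- A point to the left of all sides is in the polygon: it lies in one of the triangles of the fan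
of diagonals from the initial vertex. -/
theorem mem_of_cross_nonneg {z : ℂ}
    (h : ∀ k, 0 ≤ cross (P.vertex (k + 1) - P.vertex k) (z - P.vertex k)) : z ∈ P.carrier := by
  let ι : ℕ → Fin (P.extra + 3) := Fin.ofNat (P.extra + 3)
  have hι : ∀ k, ι (k + 1) = ι k + 1 := fun k => by ext; simp [ι, Fin.val_add]
  let v : ℕ → ℂ := fun k => P.vertex (ι k)
  have hside : ∀ k, 0 ≤ cross (v (k + 1) - v k) (z - v k) := by
    intro k
    have := h (ι k)
    rwa [← hι] at this
  have hlast : cross (v (P.extra + 2) - v 0) (z - v 0) ≤ 0 := by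
    have h1 := hside (P.extra + 2)
    have h2 : v (P.extra + 2 + 1) = v 0 := by
      refine congrArg P.vertex (Fin.ext ?_)
      simp [ι]
    rw [h2] at h1
    simp only [cross, Complex.sub_re, Complex.sub_im] at h1 ⊢
    linarith
  -- two consecutive diagonals (or sides) from the initial vertex that have the point between them
  obtain ⟨k, hk1, hk2, hp, hm⟩ : ∃ k, 1 ≤ k ∧ k + 1 ≤ P.extra + 2 ∧
      0 ≤ cross (v k - v 0) (z - v 0) ∧ cross (v (k + 1) - v 0) (z - v 0) ≤ 0 := by
    by_contra! hcon
    have : ∀ k, 1 ≤ k → k ≤ P.extra + 2 → 0 ≤ cross (v k - v 0) (z - v 0) ∧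
        (2 ≤ k → 0 < cross (v k - v 0) (z - v 0)) := by
      intro k hk
      induction k, hk using Nat.le_induction with
      | base => intro _; exact ⟨hside 0, by omega⟩
      | succ k hk ih =>
        intro hk'
        have := hcon k hk hk' (ih (by omega)).1
        exact ⟨this.le, fun _ => this⟩
    exact absurd hlast ((this (P.extra + 2) (by omega) le_rfl).2 (by omega)).not_ge
  have hne : ∀ j, 1 ≤ j → j ≤ P.extra + 2 → ι 0 ≠ ι j := by
    intro j h1 h2 h3
    have := congrArg Fin.val h3
    simp only [ι, Fin.ofNat, Nat.zero_mod, Nat.mod_eq_of_lt (by omega : j < P.extra + 3)] at this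
    omega
  have hD := P.left_of_side (ι k) (ι 0) (hne k hk1 (by omega))
    (hι k ▸ hne (k + 1) (by omega) hk2)
  have hD' : 0 < cross (v (k + 1) - v k) (v 0 - v k) := by
    rwa [← hι] at hD
  refine mem_convexHull_triangle (e := v k) (f := v (k + 1)) (n := v 0) ⟨_, rfl⟩ ⟨_, rfl⟩
    ⟨_, rfl⟩ hD' (hside k) ?_ ?_
  · simp only [cross, Complex.sub_re, Complex.sub_im] at hm ⊢
    linarith
  · exact hp

end ConvexPolygon

/-! ### Counting segments that cross a line -/

/-- If segments of a list have their ends strictly on the two sides of one line, then their number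
is at most the variation factor. -/
theorem card_le_variationFactor_of_strict {n : ℕ} {x : ℕ → ℂ} {I : Finset ℕ}
    (hI : I ⊆ Finset.range n) {u : ℂ} (hu : u ≠ 0) {r : ℝ}
    (h : ∀ i ∈ I, (⟪u, x i⟫_ℝ < r ∧ r < ⟪u, x (i + 1)⟫_ℝ) ∨
      (⟪u, x (i + 1)⟫_ℝ < r ∧ r < ⟪u, x i⟫_ℝ)) :
    (I.card : ℝ≥0∞) ≤ variationFactor n x := by
  classical
  rcases I.eq_empty_or_nonempty with rfl | ⟨i₀, hi₀⟩
  · simp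
  have hn : n ≠ 0 := by
    have := Finset.mem_range.1 (hI hi₀)
    omega
  have hN : u.re * u.re + u.im * u.im ≠ 0 := by
    rw [← Complex.normSq_apply]
    exact Complex.normSq_eq_zero.not.2 hu
  -- the line with normal `u` at height `r`
  set N := u.re * u.re + u.im * u.im with hNdef
  let p : ℂ := ⟨r * u.re / N, r * u.im / N⟩
  let q : ℂ := ⟨r * u.re / N - u.im, r * u.im / N + u.re⟩
  have hpq : p ≠ q := by
    intro h
    have h1 := congrArg Complex.re h
    have h2 := congrArg Complex.im h
    simp only [p, q] at h1 h2
    exact hu (Complex.ext (by simp; linarith) (by simp; linarith))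
  have hmem : ∀ z, z ∈ line[ℝ, p, q] ↔ ⟪u, z⟫_ℝ = r := by
    intro z
    rw [mem_line_iff_cross_eq_zero hpq, real_inner_eq]
    have : cross (q - p) (z - p) = r - (u.re * z.re + u.im * z.im) := by
      simp only [cross, p, q, Complex.sub_re, Complex.sub_im]
      field_simp
      rw [hNdef]
      ring
    rw [this, sub_eq_zero, eq_comm]
  have hopp : ∀ a b : ℂ, ⟪u, a⟫_ℝ < r → r < ⟪u, b⟫_ℝ → line[ℝ, p, q].SOppSide a b := by
    intro a b ha hb
    refine ⟨AffineSubspace.wOppSide_iff_exists_wbtw.2 ?_, ?_, ?_⟩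
    · refine ⟨AffineMap.lineMap a b ((r - ⟪u, a⟫_ℝ) / (⟪u, b⟫_ℝ - ⟪u, a⟫_ℝ)), ?_, _, ⟨?_, ?_⟩, rfl⟩
      · rw [hmem, AffineMap.lineMap_apply, vsub_eq_sub, vadd_eq_add, inner_add_right,
          inner_smul_right, inner_sub_right]
        have : ⟪u, b⟫_ℝ - ⟪u, a⟫_ℝ ≠ 0 := by linarith
        field_simp
        ring
      · exact div_nonneg (by linarith) (by linarith)
      · rw [div_le_one (by linarith)]
        linarith
    · rw [hmem]; exact ha.ne
    · rw [hmem]; exact hb.ne'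
  refine le_trans ?_ (le_iSup₂_of_le (line[ℝ, p, q]) ⟨p, q, hpq, rfl⟩ le_rfl)
  rw [crossingCount, if_neg hn]
  norm_cast
  refine Finset.card_le_card fun i hi => ?_
  rw [Finset.mem_filter]
  refine ⟨hI hi, Or.inl ?_⟩
  rcases h i hi with ⟨h1, h2⟩ | ⟨h1, h2⟩
  · exact hopp _ _ h1 h2
  · exact (hopp _ _ h1 h2).symm

/-- The segments that pass between an open half-plane and its complement number at most the
variation factor, because a small translation of the boundary line makes them all cross it
strictly. -/
theorem card_le_variationFactor_of_halfPlane {n : ℕ} {x : ℕ → ℂ} {I : Finset ℕ}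
    (hI : I ⊆ Finset.range n) {u : ℂ} {r : ℝ}
    (h : ∀ i ∈ I, (⟪u, x i⟫_ℝ < r ∧ r ≤ ⟪u, x (i + 1)⟫_ℝ) ∨
      (⟪u, x (i + 1)⟫_ℝ < r ∧ r ≤ ⟪u, x i⟫_ℝ)) :
    (I.card : ℝ≥0∞) ≤ variationFactor n x := by
  rcases I.eq_empty_or_nonempty with rfl | ⟨i₀, hi₀⟩
  · simp
  have hu : u ≠ 0 := by
    rintro rfl
    simp only [inner_zero_left] at h
    rcases h i₀ hi₀ with h' | h' <;> linarith [h'.1, h'.2]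
  have hev : ∀ᶠ s in nhdsWithin r (Set.Iio r), s < r ∧
      ∀ i ∈ Finset.range (n + 1), ⟪u, x i⟫_ℝ < r → ⟪u, x i⟫_ℝ < s := by
    refine Filter.Eventually.and self_mem_nhdsWithin ?_
    rw [Filter.eventually_all_finset]
    intro i _
    by_cases hi : ⟪u, x i⟫_ℝ < r
    · filter_upwards [mem_nhdsWithin_of_mem_nhds (lt_mem_nhds hi)] with s hs _ using hs
    · exact Filter.Eventually.of_forall fun s h => absurd h hi
  obtain ⟨s, hs, hlt⟩ := hev.exists
  refine card_le_variationFactor_of_strict hI hu (r := s) fun i hi => ?_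
  have hin := Finset.mem_range.1 (hI hi)
  rcases h i hi with ⟨h1, h2⟩ | ⟨h1, h2⟩
  · exact Or.inl ⟨hlt i (by simp; omega) h1, hs.trans_le h2⟩
  · exact Or.inr ⟨hlt (i + 1) (by simp; omega) h1, hs.trans_le h2⟩

/-! ### Two-dimensional variation is bounded by parametrized variation -/

/-- If no gap between two points is covered by more than `N` of the given intervals, then the
increments of a function over these intervals add up to at most `N` times its total variation. -/
theorem sum_edist_le_mul_eVariationOn {α E ι : Type*} [LinearOrder α] [PseudoEMetricSpace E]
    (F : α → E) (I : Finset ι) (a b : ι → α) (N : ℝ≥0∞)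
    (hN : ∀ s t, s < t →
      ((I.filter (fun i => min (a i) (b i) ≤ s ∧ t ≤ max (a i) (b i))).card : ℝ≥0∞) ≤ N) :
    ∑ i ∈ I, edist (F (b i)) (F (a i)) ≤ N * eVariationOn F Set.univ := by
  classical
  rcases I.eq_empty_or_nonempty with rfl | ⟨i₀, hi₀⟩
  · simp
  -- the endpoints of the intervals, in increasing order
  set T := I.image a ∪ I.image b with hT
  have hTpos : 0 < T.card :=
    Finset.card_pos.2 ⟨a i₀, Finset.mem_union_left _ (Finset.mem_image_of_mem a hi₀)⟩
  let p : ℕ → α := fun j => T.orderEmbOfFin rfl ⟨min j (T.card - 1), by omega⟩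
  have hp : Monotone p := fun i j hij =>
    (T.orderEmbOfFin rfl).monotone (min_le_min_right _ hij)
  have hpT : ∀ y ∈ T, ∃ j, j ≤ T.card - 1 ∧ p j = y := by
    intro y hy
    obtain ⟨k, hk⟩ : y ∈ Set.range (T.orderEmbOfFin rfl) := by
      rw [Finset.range_orderEmbOfFin]; exact hy
    refine ⟨k, by omega, ?_⟩
    rw [← hk]
    simp only [p]
    congr 1
    ext
    simp
    omega
  set m := T.card - 1 with hm
  let e : ℕ → ℝ≥0∞ := fun j => edist (F (p (j + 1))) (F (p j))
  have hone : ∀ i ∈ I, edist (F (b i)) (F (a i)) ≤ ∑ j ∈ Finset.range m,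
      if min (a i) (b i) ≤ p j ∧ p (j + 1) ≤ max (a i) (b i) then e j else 0 := by
    intro i hi
    have ha : a i ∈ T := Finset.mem_union_left _ (Finset.mem_image_of_mem a hi)
    have hb : b i ∈ T := Finset.mem_union_right _ (Finset.mem_image_of_mem b hi)
    have hlo : min (a i) (b i) ∈ T := by rcases min_choice (a i) (b i) with h | h <;> rwa [h]
    have hhi : max (a i) (b i) ∈ T := by rcases max_choice (a i) (b i) with h | h <;> rwa [h]
    have hed : edist (F (b i)) (F (a i)) =
        edist (F (min (a i) (b i))) (F (max (a i) (b i))) := by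
      rcases le_total (a i) (b i) with h | h
      · rw [min_eq_left h, max_eq_right h, edist_comm]
      · rw [min_eq_right h, max_eq_left h]
    obtain ⟨k, -, hk⟩ := hpT _ hlo
    obtain ⟨l, hl', hl⟩ := hpT _ hhi
    rw [hed]
    rcases le_total l k with hkl | hkl
    · have : min (a i) (b i) = max (a i) (b i) :=
        le_antisymm min_le_max (by rw [← hk, ← hl]; exact hp hkl)
      rw [this, edist_self]
      exact zero_le
    · rw [← hk, ← hl]
      refine (edist_le_Ico_sum_edist (fun j => F (p j)) hkl).trans ?_
      rw [← Finset.sum_filter]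
      refine (Finset.sum_le_sum fun j _ => (edist_comm _ _).le).trans
        (Finset.sum_le_sum_of_subset ?_)
      intro j hj
      rw [Finset.mem_Ico] at hj
      rw [Finset.mem_filter, Finset.mem_range]
      exact ⟨by omega, hp hj.1, hp hj.2⟩
  calc ∑ i ∈ I, edist (F (b i)) (F (a i))
      ≤ ∑ i ∈ I, ∑ j ∈ Finset.range m,
          if min (a i) (b i) ≤ p j ∧ p (j + 1) ≤ max (a i) (b i) then e j else 0 :=
        Finset.sum_le_sum hone
    _ = ∑ j ∈ Finset.range m, ((I.filter fun i =>
          min (a i) (b i) ≤ p j ∧ p (j + 1) ≤ max (a i) (b i)).card : ℝ≥0∞) * e j := by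
        rw [Finset.sum_comm]
        refine Finset.sum_congr rfl fun j _ => ?_
        rw [← Finset.sum_filter, Finset.sum_const, nsmul_eq_mul]
    _ ≤ ∑ j ∈ Finset.range m, N * e j := by
        refine Finset.sum_le_sum fun j _ => ?_
        rcases (hp j.le_succ).lt_or_eq with h | h
        · exact mul_le_mul_left (hN _ _ h) _
        · simp only [e]
          rw [← Nat.succ_eq_add_one, ← h, edist_self, mul_zero, mul_zero]
    _ ≤ N * eVariationOn F Set.univ := by
        rw [← Finset.mul_sum]
        exact mul_le_mul_right (eVariationOn.sum_le hp fun _ => Set.mem_univ _) _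

/-- The segments of a list with both ends on a projectable convex curve contribute to the curve
variation at most the variation factor times the parametrized variation: those that cover a gap of
the parameter interval all cross a line that separates the two parts of the curve. -/
theorem ConvexCurve.sum_enorm_sub_le (c : ConvexCurve) (hc : c.IsProjectable) {σ : Set ℂ}
    (h : c.carrier ⊆ σ) (f : σ → ℂ) {n : ℕ} (x : ℕ → σ) {I : Finset ℕ} (hI : I ⊆ Finset.range n)
    (hx : ∀ i ∈ I, (x i : ℂ) ∈ c.carrier ∧ (x (i + 1) : ℂ) ∈ c.carrier) :
    ∑ i ∈ I, ‖f (x (i + 1)) - f (x i)‖ₑ ≤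
      variationFactor n (fun i => (x i : ℂ)) * c.pvar (f ∘ Set.inclusion h) := by
  classical
  have hex : ∀ z : σ, ∃ t : Set.Icc (0 : ℝ) c.length, (z : ℂ) ∈ c.carrier → c.param t = z := by
    intro z
    by_cases hz : (z : ℂ) ∈ c.carrier
    · obtain ⟨t, ht, htz⟩ := hz
      exact ⟨⟨t, ht⟩, fun _ => htz⟩
    · exact ⟨⟨0, le_rfl, c.length_pos.le⟩, fun h => absurd h hz⟩
  choose τ hτ using hex
  have hF : ∀ z : σ, (z : ℂ) ∈ c.carrier →
      (f ∘ Set.inclusion h) ⟨c.param (τ z), Set.mem_image_of_mem c.param (τ z).2⟩ = f z :=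
    fun z hz => congrArg f (Subtype.ext (hτ z hz))
  have hsum : ∑ i ∈ I, ‖f (x (i + 1)) - f (x i)‖ₑ = ∑ i ∈ I,
      edist ((f ∘ Set.inclusion h) ⟨c.param (τ (x (i + 1))), Set.mem_image_of_mem c.param (τ _).2⟩)
        ((f ∘ Set.inclusion h) ⟨c.param (τ (x i)), Set.mem_image_of_mem c.param (τ _).2⟩) := by
    refine Finset.sum_congr rfl fun i hi => ?_
    rw [hF _ (hx i hi).1, hF _ (hx i hi).2, edist_eq_enorm_sub]
  rw [hsum]
  refine sum_edist_le_mul_eVariationOn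
    (fun t : Set.Icc (0 : ℝ) c.length =>
      (f ∘ Set.inclusion h) ⟨c.param t, Set.mem_image_of_mem c.param t.2⟩)
    I (fun i => τ (x i)) (fun i => τ (x (i + 1))) _ fun s t hst => ?_
  obtain ⟨u, r, h1, h2⟩ := c.exists_separating_line hc s.2.1 hst t.2.2
  have hu : u ≠ 0 := by
    rintro rfl
    have h3 := h1 s ⟨s.2.1, le_rfl⟩
    have h4 := h2 t ⟨le_rfl, t.2.2⟩
    rw [inner_zero_left] at h3 h4
    exact lt_asymm h3 h4
  refine card_le_variationFactor_of_strict ((Finset.filter_subset _ _).trans hI) hu (r := r) ?_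
  intro i hi
  obtain ⟨hiI, hlo, hhi⟩ := Finset.mem_filter.1 hi
  rw [← hτ _ (hx i hiI).1, ← hτ _ (hx i hiI).2]
  have key : ∀ y z : Set.Icc (0 : ℝ) c.length, y ≤ s → t ≤ z →
      ⟪u, c.param y⟫_ℝ < r ∧ r < ⟪u, c.param z⟫_ℝ := fun y z hy hz =>
    ⟨h1 y ⟨y.2.1, hy⟩, h2 z ⟨hz, z.2.2⟩⟩
  rcases le_total (τ (x i)) (τ (x (i + 1))) with hle | hle
  · rw [min_eq_left hle] at hlo
    rw [max_eq_right hle] at hhi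
    exact Or.inl (key _ _ hlo hhi)
  · rw [min_eq_right hle] at hlo
    rw [max_eq_left hle] at hhi
    exact Or.inr (key _ _ hlo hhi)

theorem enorm_sub_le_two_mul_supNorm {σ : Set ℂ} (f : σ → ℂ) (y z : σ) :
    ‖f y - f z‖ₑ ≤ 2 * supNorm f := by
  rw [two_mul]
  exact enorm_sub_le.trans (add_le_add (le_iSup (fun z => ‖f z‖ₑ) y) (le_iSup (fun z => ‖f z‖ₑ) z))

/-- The segments of a list with exactly one end in a convex polygon number at most the number of
sides times the variation factor: each of them passes between the two half-planes of some side. -/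
theorem ConvexPolygon.card_le_of_mem_xor (P : ConvexPolygon) {n : ℕ} {x : ℕ → ℂ} {I : Finset ℕ}
    (hI : I ⊆ Finset.range n)
    (h : ∀ i ∈ I, (x i ∈ P.carrier ∧ x (i + 1) ∉ P.carrier) ∨
      (x i ∉ P.carrier ∧ x (i + 1) ∈ P.carrier)) :
    (I.card : ℝ≥0∞) ≤ P.numSides * variationFactor n x := by
  classical
  let u : Fin (P.extra + 3) → ℂ := fun k =>
    ⟨-(P.vertex (k + 1) - P.vertex k).im, (P.vertex (k + 1) - P.vertex k).re⟩
  let r : Fin (P.extra + 3) → ℝ := fun k => ⟪u k, P.vertex k⟫_ℝ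
  have hu : ∀ k z, cross (P.vertex (k + 1) - P.vertex k) (z - P.vertex k) = ⟪u k, z⟫_ℝ - r k := by
    intro k z
    rw [cross_eq_inner, inner_sub_right]
  have hin : ∀ z ∈ P.carrier, ∀ k, r k ≤ ⟪u k, z⟫_ℝ := by
    intro z hz k
    have := P.cross_nonneg_of_mem hz k
    rw [hu] at this
    linarith
  have hout : ∀ z ∉ P.carrier, ∃ k, ⟪u k, z⟫_ℝ < r k := by
    intro z hz
    by_contra! hcon
    refine hz (P.mem_of_cross_nonneg fun k => ?_)
    rw [hu]
    linarith [hcon k]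
  let J : Fin (P.extra + 3) → Finset ℕ := fun k => I.filter fun i =>
    (⟪u k, x i⟫_ℝ < r k ∧ r k ≤ ⟪u k, x (i + 1)⟫_ℝ) ∨
      (⟪u k, x (i + 1)⟫_ℝ < r k ∧ r k ≤ ⟪u k, x i⟫_ℝ)
  have hsub : I ⊆ Finset.univ.biUnion J := by
    intro i hi
    rw [Finset.mem_biUnion]
    rcases h i hi with ⟨h1, h2⟩ | ⟨h1, h2⟩
    · obtain ⟨k, hk⟩ := hout _ h2
      exact ⟨k, Finset.mem_univ _, Finset.mem_filter.2 ⟨hi, Or.inr ⟨hk, hin _ h1 k⟩⟩⟩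
    · obtain ⟨k, hk⟩ := hout _ h1
      exact ⟨k, Finset.mem_univ _, Finset.mem_filter.2 ⟨hi, Or.inl ⟨hk, hin _ h2 k⟩⟩⟩
  calc (I.card : ℝ≥0∞) ≤ ∑ k, ((J k).card : ℝ≥0∞) := by
        exact_mod_cast (Finset.card_le_card hsub).trans Finset.card_biUnion_le
    _ ≤ ∑ _k : Fin (P.extra + 3), variationFactor n x :=
        Finset.sum_le_sum fun k _ => card_le_variationFactor_of_halfPlane
          ((Finset.filter_subset _ _).trans hI) (u := u k) (r := r k)
          fun i hi => (Finset.mem_filter.1 hi).2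
    _ = P.numSides * variationFactor n x := by
        simp [ConvexPolygon.numSides]

namespace Decomposition

variable {σ : Set ℂ} {M : ℕ}

/-- The segments of a list that join points of no common component number at most
`(M - 1) * S(𝓜)` times the variation factor: each of them leaves or enters some polygon, and one
polygon of the mosaic, here `i₀`, can be avoided because a segment meets two of them. -/
theorem card_le_of_no_common_component (D : Decomposition σ M) (i₀ : Fin M) {n : ℕ} {x : ℕ → σ}
    {I : Finset ℕ} (hI : I ⊆ Finset.range n)
    (h : ∀ i ∈ I, ∀ k, ¬((x i : ℂ) ∈ (D.component k).carrier ∧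
      (x (i + 1) : ℂ) ∈ (D.component k).carrier)) :
    (I.card : ℝ≥0∞) ≤ ((M - 1 : ℕ) : ℝ≥0∞) * D.mosaic.maxSides *
      variationFactor n (fun i => (x i : ℂ)) := by
  classical
  let J : Fin M → Finset ℕ := fun a => I.filter fun i =>
    ((x i : ℂ) ∈ (D.mosaic.polygon a).carrier ∧ (x (i + 1) : ℂ) ∉ (D.mosaic.polygon a).carrier) ∨
    ((x i : ℂ) ∉ (D.mosaic.polygon a).carrier ∧ (x (i + 1) : ℂ) ∈ (D.mosaic.polygon a).carrier)
  have hsub : I ⊆ (Finset.univ.erase i₀).biUnion J := by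
    intro i hi
    obtain ⟨a, ha⟩ := Set.mem_iUnion.1 (D.covers (x i).2)
    obtain ⟨b, hb⟩ := Set.mem_iUnion.1 (D.covers (x (i + 1)).2)
    have hno : ∀ k, (x i : ℂ) ∈ (D.mosaic.polygon k).carrier →
        (x (i + 1) : ℂ) ∉ (D.mosaic.polygon k).carrier := fun k h1 h2 =>
      h i hi k ⟨by rw [D.carrier_eq]; exact ⟨(x i).2, h1⟩,
        by rw [D.carrier_eq]; exact ⟨(x (i + 1)).2, h2⟩⟩
    rw [Finset.mem_biUnion]
    by_cases hb0 : b = i₀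
    · have ha0 : a ≠ i₀ := by
        rintro rfl
        exact hno a ha (hb0 ▸ hb)
      exact ⟨a, Finset.mem_erase.2 ⟨ha0, Finset.mem_univ _⟩,
        Finset.mem_filter.2 ⟨hi, Or.inl ⟨ha, hno a ha⟩⟩⟩
    · exact ⟨b, Finset.mem_erase.2 ⟨hb0, Finset.mem_univ _⟩,
        Finset.mem_filter.2 ⟨hi, Or.inr ⟨fun h1 => hno b h1 hb, hb⟩⟩⟩
  set V := variationFactor n (fun i => (x i : ℂ)) with hV
  calc (I.card : ℝ≥0∞) ≤ ∑ a ∈ Finset.univ.erase i₀, ((J a).card : ℝ≥0∞) := by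
        exact_mod_cast (Finset.card_le_card hsub).trans Finset.card_biUnion_le
    _ ≤ ∑ _a ∈ Finset.univ.erase i₀, (D.mosaic.maxSides : ℝ≥0∞) * V := by
        refine Finset.sum_le_sum fun a _ => ?_
        refine ((D.mosaic.polygon a).card_le_of_mem_xor ((Finset.filter_subset _ _).trans hI)
          (x := fun i => (x i : ℂ)) fun i hi => (Finset.mem_filter.1 hi).2).trans ?_
        refine mul_le_mul_left ?_ _
        exact_mod_cast Finset.le_sup (f := fun i => (D.mosaic.polygon i).numSides)
          (Finset.mem_univ a)
    _ = ((M - 1 : ℕ) : ℝ≥0∞) * D.mosaic.maxSides * V := by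
        rw [Finset.sum_const, Finset.card_erase_of_mem (Finset.mem_univ _), Finset.card_univ,
          Fintype.card_fin, nsmul_eq_mul, mul_assoc]

/-- The two-dimensional variation is at most the sum of the variations along the components, plus
the contribution of the segments between different components. -/
theorem variation_le (D : Decomposition σ M) (hproj : D.IsProjectable) (i₀ : Fin M) (f : σ → ℂ) :
    variation f ≤ ∑ k, (D.component k).pvar (f ∘ Set.inclusion (D.component_subset k)) +
      2 * ((M - 1 : ℕ) : ℝ≥0∞) * D.mosaic.maxSides * supNorm f := by
  classical
  refine iSup_le fun n => iSup_le fun x => iSup_le fun _ => ENNReal.div_le_of_le_mul ?_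
  set V := variationFactor n (fun i => (x i : ℂ)) with hV
  let I : Fin M → Finset ℕ := fun k => (Finset.range n).filter fun i =>
    (x i : ℂ) ∈ (D.component k).carrier ∧ (x (i + 1) : ℂ) ∈ (D.component k).carrier
  let J : Finset ℕ := (Finset.range n).filter fun i => ∀ k,
    ¬((x i : ℂ) ∈ (D.component k).carrier ∧ (x (i + 1) : ℂ) ∈ (D.component k).carrier)
  have hsame : ∑ k, ∑ i ∈ I k, ‖f (x (i + 1)) - f (x i)‖ₑ ≤
      V * ∑ k, (D.component k).pvar (f ∘ Set.inclusion (D.component_subset k)) := by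
    rw [Finset.mul_sum]
    refine Finset.sum_le_sum fun k _ => ?_
    exact (D.component k).sum_enorm_sub_le (hproj k) (D.component_subset k) f x
      (Finset.filter_subset _ _) fun i hi => (Finset.mem_filter.1 hi).2
  have hdiff : ∑ i ∈ J, ‖f (x (i + 1)) - f (x i)‖ₑ ≤
      ((M - 1 : ℕ) : ℝ≥0∞) * D.mosaic.maxSides * V * (2 * supNorm f) := by
    refine (Finset.sum_le_card_nsmul _ _ _ fun i _ =>
      enorm_sub_le_two_mul_supNorm f (x (i + 1)) (x i)).trans ?_
    rw [nsmul_eq_mul]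
    exact mul_le_mul_left (D.card_le_of_no_common_component i₀ (Finset.filter_subset _ _)
      fun i hi => (Finset.mem_filter.1 hi).2) _
  calc curveVariation f n x
      ≤ ∑ k, ∑ i ∈ I k, ‖f (x (i + 1)) - f (x i)‖ₑ + ∑ i ∈ J, ‖f (x (i + 1)) - f (x i)‖ₑ := by
        simp only [I, J, Finset.sum_filter]
        rw [Finset.sum_comm, ← Finset.sum_add_distrib]
        refine Finset.sum_le_sum fun i _ => ?_
        by_cases h : ∃ k, (x i : ℂ) ∈ (D.component k).carrier ∧
            (x (i + 1) : ℂ) ∈ (D.component k).carrier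
        · obtain ⟨k, hk⟩ := h
          refine le_trans ?_ le_self_add
          refine le_trans ?_ (Finset.single_le_sum (fun _ _ => zero_le) (Finset.mem_univ k))
          rw [if_pos hk]
        · rw [if_pos (not_exists.1 h)]
          exact le_add_self
    _ ≤ V * ∑ k, (D.component k).pvar (f ∘ Set.inclusion (D.component_subset k)) +
          ((M - 1 : ℕ) : ℝ≥0∞) * D.mosaic.maxSides * V * (2 * supNorm f) :=
        add_le_add hsame hdiff
    _ = _ := by ring

end Decomposition

end PolyInscribed

theorem mainTheorem4 (σ : Set ℂ) (hσ : σ ∈ PolyInscribed.PIC) (M : ℕ)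
    (D : PolyInscribed.Decomposition σ M) (hsimple : D.IsSimple) (hproj : D.IsProjectable) :
    PolyInscribed.BV σ = {f : σ → ℂ | D.picNorm f < ∞} ∧
    (∀ f : σ → ℂ, D.picNorm f ≤ 2 * (M : ℝ≥0∞) * PolyInscribed.bvNorm f) ∧
    (∀ f : σ → ℂ, PolyInscribed.bvNorm f ≤
      ((M : ℝ≥0∞) + 2 * ((M - 1 : ℕ) : ℝ≥0∞) * (D.mosaic.maxSides : ℝ≥0∞)) * D.picNorm f) := by
  obtain ⟨z, hz⟩ := hσ.2.1.nonempty
  obtain ⟨i₀, -⟩ := Set.mem_iUnion.1 (D.covers hz)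
  have hM : (1 : ℝ≥0∞) ≤ M := by exact_mod_cast i₀.pos
  have h1 : ∀ f : σ → ℂ, D.picNorm f ≤ 2 * (M : ℝ≥0∞) * PolyInscribed.bvNorm f := by
    intro f
    rw [PolyInscribed.Decomposition.picNorm, PolyInscribed.bvNorm, mul_add]
    refine add_le_add (le_mul_of_one_le_left' ?_) ?_
    · exact hM.trans (le_mul_of_one_le_left' (by norm_num))
    · refine (Finset.sum_le_card_nsmul _ _ _ fun k _ =>
        (D.component k).pvar_le_two_mul_variation (D.component_subset k) f).trans (le_of_eq ?_)
      rw [Finset.card_univ, Fintype.card_fin, nsmul_eq_mul]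
      ring
  have h2 : ∀ f : σ → ℂ, PolyInscribed.bvNorm f ≤
      ((M : ℝ≥0∞) + 2 * ((M - 1 : ℕ) : ℝ≥0∞) * (D.mosaic.maxSides : ℝ≥0∞)) * D.picNorm f := by
    intro f
    rw [PolyInscribed.Decomposition.picNorm, PolyInscribed.bvNorm]
    set P := ∑ k, (D.component k).pvar (f ∘ Set.inclusion (D.component_subset k))
    set K := 2 * ((M - 1 : ℕ) : ℝ≥0∞) * (D.mosaic.maxSides : ℝ≥0∞)
    set s := PolyInscribed.supNorm f
    calc s + PolyInscribed.variation f ≤ s + (P + K * s) := by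
          gcongr
          exact D.variation_le hproj i₀ f
      _ ≤ (s + P) + K * (s + P) := by
          rw [← add_assoc]
          gcongr
          exact le_self_add
      _ ≤ (M + K) * (s + P) := by
          rw [add_mul]
          gcongr
          exact le_mul_of_one_le_left' hM
  refine ⟨Set.ext fun f => ⟨fun hf => ?_, fun hf => ?_⟩, h1, h2⟩
  · refine (h1 f).trans_lt (ENNReal.mul_lt_top ?_ hf)
    exact ENNReal.mul_lt_top (by norm_num) (ENNReal.natCast_lt_top _)
  · refine (h2 f).trans_lt (ENNReal.mul_lt_top (ENNReal.add_lt_top.2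
      ⟨ENNReal.natCast_lt_top _, ?_⟩) hf)
    exact ENNReal.mul_lt_top (ENNReal.mul_lt_top (by norm_num) (ENNReal.natCast_lt_top _))
      (ENNReal.natCast_lt_top _)
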